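/- Let $N>0$ be an integer, let $f_0,\dots,f_N$ be entire functions that are real-valued on the real line, and put $S_N(z)=\sum_{j=0}^N\eta_jf_j(z)$ with $\eta_j=a_j+ib_j$, where $a_0,\dots,a_N,b_0,\dots,b_N$ are mutually independent real random variables. For a level $\mathbf K=K_1+iK_2$ and compact $\Phi\subset\mathbb C$ let $\nu_{N,\mathbf K}(\Phi)$ be the number of $z\in\Phi$ with $S_N(z)=\mathbf K$; the density $h_{N,\mathbf K}$ is the locally integrable function with $$\mathbb E\,\nu_{N,\mathbf K}(\Phi)=\int_\Phi h_{N,\mathbf K}(z)\,dx\,dy\qquad(z=x+iy)\quad\text{for every compact }\Phi\subset\mathbb C .$$ Let $$B_0(z)=\sum_{j=0}^N|f_j(z)|^2,\qquad B_1(z)=\sum_{j=0}^N\overline{f_j(z)}\,f_j'(z),\qquad B_2(z)=\sum_{j=0}^N|f_j'(z)|^2 .$$ Let $K>0$, and suppose that either (i) each $\eta_j$ has density $e^{-z\bar z}/\pi$ and $\mathbf K$ lies on the circle of radius $K$ about $0$, that is, $K_1^2+K_2^2=K^2$; or (ii) the $a_j$ and $b_j$ are normal with mean $0$ and variance $1$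 and $(K_1^2+K_2^2)/2=K^2$ (for instance $K_1=K_2=K$). Then every $\nu_{N,\mathbf K}(\Phi)$ with $\Phi$ compact has finite expectation, the density $h_{N,\mathbf K}$ exists, and $$h_{N,\mathbf K}(z)=\frac{e^{-K^2/B_0(z)}}{\pi B_0(z)}\left\{B_2(z)-\frac{|B_1(z)|^2}{B_0(z)}\left(1-\frac{K^2}{B_0(z)}\right)\right\}.$$ The equality holds for almost every $z$ (the right-hand side being read as $0$ where $B_0(z)=0$), which determines $h_{N,\mathbf K}$ up to null sets, and at every $z$ with $B_0(z)\neq0$ at which the chosen version of $h_{N,\mathbf K}$ is continuous. -/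

import Mathlib

open MeasureTheory ProbabilityTheory

/-- The complex random variable `x + i y` with real and imaginary parts `x`, `y`. -/
noncomputable def complexOfParts {Ω : Type*} (x y : Ω → ℝ) (ω : Ω) : ℂ :=
  (x ω : ℂ) + Complex.I * (y ω : ℂ)

/-- The random sum `S_N(z) = ∑ j, η_j f_j(z)`, with `η_j = a_j + i b_j`. -/
noncomputable def randomSum {Ω : Type*} {N : ℕ} (a b : Fin (N + 1) → Ω → ℝ)
    (f : Fin (N + 1) → ℂ → ℂ) (ω : Ω) (z : ℂ) : ℂ :=
  ∑ j, complexOfParts (a j) (b j) ω * f j z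

/-- The number (possibly infinite) of solutions in `Φ` of the equation `S(z) = κ`. -/
noncomputable def zeroCount (S : ℂ → ℂ) (κ : ℂ) (Φ : Set ℂ) : ENNReal :=
  ((Set.encard {z | z ∈ Φ ∧ S z = κ} : ℕ∞) : ENNReal)

/-- `h` is an expected density of the solutions of the random equation `S ω z = κ`: for every
compact `Φ`, the number of solutions in `Φ` is a random variable of finite expectation
`∫_Φ h(z) dx dy`. -/
structure IsZeroDensity {Ω : Type*} [MeasurableSpace Ω] (P : Measure Ω)
    (S : Ω → ℂ → ℂ) (κ : ℂ) (h : ℂ → ℝ) : Prop where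
  locallyIntegrable : LocallyIntegrable h volume
  aemeasurable_count : ∀ Φ : Set ℂ, IsCompact Φ →
    AEMeasurable (fun ω => zeroCount (S ω) κ Φ) P
  expectation_ne_top : ∀ Φ : Set ℂ, IsCompact Φ →
    ∫⁻ ω, zeroCount (S ω) κ Φ ∂P ≠ ⊤
  expectation_eq : ∀ Φ : Set ℂ, IsCompact Φ →
    (∫⁻ ω, zeroCount (S ω) κ Φ ∂P).toReal = ∫ z in Φ, h z

/-- `B_{0,N}(z) = ∑ j, |f_j(z)|²`. -/
noncomputable def kernelB0 {N : ℕ} (f : Fin (N + 1) → ℂ → ℂ) (z : ℂ) : ℝ :=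
  ∑ j, ‖f j z‖ ^ 2

/-- `B_{1,N}(z) = ∑ j, conj (f_j(z)) f_j'(z)`. -/
noncomputable def kernelB1 {N : ℕ} (f : Fin (N + 1) → ℂ → ℂ) (z : ℂ) : ℂ :=
  ∑ j, (starRingEnd ℂ) (f j z) * deriv (f j) z

/-- `B_{2,N}(z) = ∑ j, |f_j'(z)|²`. -/
noncomputable def kernelB2 {N : ℕ} (f : Fin (N + 1) → ℂ → ℂ) (z : ℂ) : ℝ :=
  ∑ j, ‖deriv (f j) z‖ ^ 2

/-- `exp(-K²/B₀) / (π B₀) * {B₂ - (|B₁|²/B₀) (1 - K²/B₀)}`, meaningful where `B₀ ≠ 0`. -/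
noncomputable def circleDensity {N : ℕ} (f : Fin (N + 1) → ℂ → ℂ) (K : ℝ) (z : ℂ) : ℝ :=
  Real.exp (-K ^ 2 / kernelB0 f z) / (Real.pi * kernelB0 f z) *
    (kernelB2 f z - ‖kernelB1 f z‖ ^ 2 / kernelB0 f z * (1 - K ^ 2 / kernelB0 f z))

/-- The law on `ℂ` with density `e^{-z z̄} / π` with respect to Lebesgue measure. -/
noncomputable def stdComplexGaussian : Measure ℂ :=
  volume.withDensity fun z => ENNReal.ofReal (Real.exp (-‖z‖ ^ 2) / Real.pi)

/-!
The formula is an exact Kac–Rice computation: no limit over shrinking neighbourhoods of the level is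
taken. At a point where `f k` does not vanish, the equation `∑ j, η j * f j z = κ` says that `η k`
equals `G z`, where `G = (κ - ∑ j ≠ k, η j * f j) / f k` is holomorphic and does not involve `η k`.
With the other coefficients frozen, the expected number of solutions is thus an average, over the
values `η k` of `G`, of the number of preimages; the area formula with multiplicity
(`lintegral_zeroCount_mul`) turns it into the integral of `|G'|²` times the Gaussian density at `G`.
Tonelli's theorem then leaves a Gaussian integral over the other coefficients at a fixed `z`, which
is evaluated one coefficient at a time by completing the square (`lintegral_kacRice_step`): each
coefficient adds its contribution to the covariance data `B₀`, `B₁`, `B₂` and keeps the shape of the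
integrand.

A compact set is cut into pieces according to the first `f k` that does not vanish
(`lintegral_zeroCount_pi`). At common zeros of all `f j` there are no solutions, the level being
nonzero, and the factor `exp (-K² / B₀)` keeps the density bounded near them (`circleDensity_le`).
Tonelli's theorem needs the number of solutions to be measurable in the coefficients
(`measurable_zeroCount`): on a σ-compact set it is a countable supremum of finite sums of indicators
of the events that a given σ-compact set contains a solution.

Coefficients with parts of variance one are reduced to the density `e^{-z z̄} / π` by dividing the
equation by `√2`. Two densities agree almost everywhere because their integrals over compact sets
agree.
-/

/-! ### Integrals of quadratic polynomials against complex Gaussian weights -/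

theorem integral_exp_neg_mul_normSq {c : ℝ} (hc : 0 < c) :
    ∫ ξ : ℂ, Real.exp (-c * ‖ξ‖ ^ 2) = Real.pi / c := by
  have h := Complex.integral_exp_neg_mul_rpow (p := 2) (b := c) (by norm_num) hc
  norm_num at h
  simp only [neg_mul]
  rw [h, Real.rpow_neg_one, div_eq_mul_inv]

theorem integral_normSq_mul_exp_neg_mul_normSq {c : ℝ} (hc : 0 < c) :
    ∫ ξ : ℂ, ‖ξ‖ ^ 2 * Real.exp (-c * ‖ξ‖ ^ 2) = Real.pi / c ^ 2 := by
  have h := Complex.integral_rpow_mul_exp_neg_mul_rpow (p := 2) (q := 2) (b := c)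
    (by norm_num) (by norm_num) hc
  norm_num at h
  simp only [neg_mul]
  rw [h, div_eq_mul_inv]

theorem integrable_exp_neg_mul_normSq {c : ℝ} (hc : 0 < c) :
    Integrable fun ξ : ℂ => Real.exp (-c * ‖ξ‖ ^ 2) :=
  .of_integral_ne_zero (by rw [integral_exp_neg_mul_normSq hc]; positivity)

theorem integrable_normSq_mul_exp_neg_mul_normSq {c : ℝ} (hc : 0 < c) :
    Integrable fun ξ : ℂ => ‖ξ‖ ^ 2 * Real.exp (-c * ‖ξ‖ ^ 2) :=
  .of_integral_ne_zero (by rw [integral_normSq_mul_exp_neg_mul_normSq hc]; positivity)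

theorem integrable_exp_mul_normSq_affine {c : ℝ} (hc : 0 < c) (A B : ℂ) (r : ℝ) :
    Integrable fun ξ : ℂ => Real.exp (-c * ‖ξ‖ ^ 2) * (‖A + B * ξ‖ ^ 2 + r) := by
  refine Integrable.mono' (g := fun ξ : ℂ => (2 * ‖A‖ ^ 2 + |r|) * Real.exp (-c * ‖ξ‖ ^ 2) +
      2 * ‖B‖ ^ 2 * (‖ξ‖ ^ 2 * Real.exp (-c * ‖ξ‖ ^ 2))) ?_ ?_ (Filter.Eventually.of_forall ?_)
  · exact ((integrable_exp_neg_mul_normSq hc).const_mul _).add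
      ((integrable_normSq_mul_exp_neg_mul_normSq hc).const_mul _)
  · exact Continuous.aestronglyMeasurable (by fun_prop)
  · intro ξ
    rw [Real.norm_eq_abs, abs_mul, Real.abs_exp]
    have h1 : ‖A + B * ξ‖ ^ 2 ≤ 2 * ‖A‖ ^ 2 + 2 * (‖B‖ ^ 2 * ‖ξ‖ ^ 2) := by
      have := norm_add_le A (B * ξ)
      rw [norm_mul] at this
      have h0 := norm_nonneg (A + B * ξ)
      nlinarith [sq_nonneg (‖A‖ - ‖B‖ * ‖ξ‖)]
    have h2 : |‖A + B * ξ‖ ^ 2 + r| ≤ 2 * ‖A‖ ^ 2 + 2 * (‖B‖ ^ 2 * ‖ξ‖ ^ 2) + |r| :=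
      (abs_add_le _ _).trans (by rw [abs_of_nonneg (sq_nonneg ‖A + B * ξ‖)]; linarith)
    nlinarith [mul_le_mul_of_nonneg_left h2 (Real.exp_pos (-c * ‖ξ‖ ^ 2)).le]

/-- The parallelogram law removes the cross term, since the weight is even. -/
theorem integral_exp_mul_normSq_affine {c : ℝ} (hc : 0 < c) (A B : ℂ) (r : ℝ) :
    ∫ ξ : ℂ, Real.exp (-c * ‖ξ‖ ^ 2) * (‖A + B * ξ‖ ^ 2 + r) =
      Real.pi / c * (‖A‖ ^ 2 + ‖B‖ ^ 2 / c + r) := by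
  have hI := integrable_exp_mul_normSq_affine hc A B r
  have hJ := integrable_exp_mul_normSq_affine hc A (-B) r
  have hsym : ∫ ξ : ℂ, Real.exp (-c * ‖ξ‖ ^ 2) * (‖A + B * ξ‖ ^ 2 + r) =
      ∫ ξ : ℂ, Real.exp (-c * ‖ξ‖ ^ 2) * (‖A + -B * ξ‖ ^ 2 + r) := by
    rw [← integral_neg_eq_self]
    simp
  have hsum : ∫ ξ : ℂ, (Real.exp (-c * ‖ξ‖ ^ 2) * (‖A + B * ξ‖ ^ 2 + r) +
      Real.exp (-c * ‖ξ‖ ^ 2) * (‖A + -B * ξ‖ ^ 2 + r)) =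
      2 * (Real.pi / c * (‖A‖ ^ 2 + ‖B‖ ^ 2 / c + r)) := by
    have : ∀ ξ : ℂ, Real.exp (-c * ‖ξ‖ ^ 2) * (‖A + B * ξ‖ ^ 2 + r) +
        Real.exp (-c * ‖ξ‖ ^ 2) * (‖A + -B * ξ‖ ^ 2 + r) =
        (2 * (‖A‖ ^ 2 + r)) * Real.exp (-c * ‖ξ‖ ^ 2) +
        (2 * ‖B‖ ^ 2) * (‖ξ‖ ^ 2 * Real.exp (-c * ‖ξ‖ ^ 2)) := by
      intro ξ
      have h := parallelogram_law_with_norm ℝ A (B * ξ)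
      rw [sub_eq_add_neg, ← neg_mul, norm_mul] at h
      linear_combination Real.exp (-c * ‖ξ‖ ^ 2) * h
    simp_rw [this]
    rw [integral_add ((integrable_exp_neg_mul_normSq hc).const_mul _)
      ((integrable_normSq_mul_exp_neg_mul_normSq hc).const_mul _), integral_const_mul,
      integral_const_mul, integral_exp_neg_mul_normSq hc,
      integral_normSq_mul_exp_neg_mul_normSq hc]
    field_simp
    ring
  rw [integral_add hI hJ, ← hsym] at hsum
  linarith

/-! ### The Kac–Rice integrand at a fixed point -/

/-- Value at `κ` and `p` of the Kac–Rice integrand with covariance data `s`, `b`, `c`: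
for `X` and `Y` jointly complex Gaussian and centred, with `E|X|² = s`, `E(X̄Y) = b` and
`E|Y|² = c`, this is the density of `X` at `κ` times the conditional expectation of `|p + Y|²`
given `X = κ`. For `s = 0` it is `0`, by the convention on division. -/
noncomputable def kacRice (s : ℝ) (b : ℂ) (c : ℝ) (κ p : ℂ) : ℝ :=
  Real.exp (-‖κ‖ ^ 2 / s) / (Real.pi * s) * (‖p + b * κ / s‖ ^ 2 + (c - ‖b‖ ^ 2 / s))

theorem continuous_kacRice (s : ℝ) (b : ℂ) (c : ℝ) :
    Continuous fun x : ℂ × ℂ => kacRice s b c x.1 x.2 := by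
  unfold kacRice
  fun_prop

open ComplexConjugate in
/-- Adding independent Gaussian terms `ηu` to `X` and `ηv` to `Y` is done by completing the square
in `η`, around the regression value `m` of `η` on `X + ηu`. -/
theorem kacRice_integrand_eq {s : ℝ} (hs : 0 < s) (b : ℂ) (c : ℝ) (u v κ p η : ℂ) :
    Real.exp (-‖η‖ ^ 2) / Real.pi * kacRice s b c (κ - η * u) (p + η * v) =
      Real.exp (-‖κ‖ ^ 2 / (s + ‖u‖ ^ 2)) / (Real.pi * (Real.pi * s)) *
      (Real.exp (-((s + ‖u‖ ^ 2) / s) * ‖η - conj u * κ / ((s + ‖u‖ ^ 2 : ℝ) : ℂ)‖ ^ 2) *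
      (‖(p + (b + v * conj u) * κ / ((s + ‖u‖ ^ 2 : ℝ) : ℂ)) +
        (v - b * u / s) * (η - conj u * κ / ((s + ‖u‖ ^ 2 : ℝ) : ℂ))‖ ^ 2 +
        (c - ‖b‖ ^ 2 / s))) := by
  have hs' : 0 < s + ‖u‖ ^ 2 := by positivity
  set t := s + ‖u‖ ^ 2 with ht
  have hsC : (s : ℂ) ≠ 0 := by exact_mod_cast hs.ne'
  have htC : (t : ℂ) ≠ 0 := by exact_mod_cast hs'.ne'
  have htu : (t : ℂ) = s + u * conj u := by
    rw [ht, Complex.mul_conj']; push_cast; ring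
  have hlin : p + η * v + b * (κ - η * u) / s =
      (p + (b + v * conj u) * κ / t) + (v - b * u / s) * (η - conj u * κ / t) := by
    field_simp
    rw [htu]; ring
  have hexp : -‖η‖ ^ 2 + -‖κ - η * u‖ ^ 2 / s =
      -‖κ‖ ^ 2 / t + -(t / s) * ‖η - conj u * κ / t‖ ^ 2 := by
    have : ((-‖η‖ ^ 2 + -‖κ - η * u‖ ^ 2 / s : ℝ) : ℂ) =
      ((-‖κ‖ ^ 2 / t + -(t / s) * ‖η - conj u * κ / t‖ ^ 2 : ℝ) : ℂ) := by
      push_cast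
      simp only [← Complex.mul_conj', map_sub, map_mul, map_div₀, Complex.conj_conj,
        Complex.conj_ofReal]
      field_simp
      rw [htu]; ring
    exact_mod_cast this
  unfold kacRice
  rw [hlin]
  have := congrArg Real.exp hexp
  rw [Real.exp_add, Real.exp_add] at this
  calc _ = (Real.exp (-‖η‖ ^ 2) * Real.exp (-‖κ - η * u‖ ^ 2 / s)) / (Real.pi * (Real.pi * s)) *
        (‖(p + (b + v * conj u) * κ / t) + (v - b * u / s) * (η - conj u * κ / t)‖ ^ 2 +
        (c - ‖b‖ ^ 2 / s)) := by ring
    _ = _ := by rw [this]; ring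

open ComplexConjugate in
/-- Schur complement of a `2 × 2` covariance matrix after a rank-one update. -/
theorem schur_complement_update {s : ℝ} (hs : 0 < s) (b : ℂ) (c : ℝ) (u v : ℂ) :
    ‖v - b * u / s‖ ^ 2 / ((s + ‖u‖ ^ 2) / s) + (c - ‖b‖ ^ 2 / s) =
      c + ‖v‖ ^ 2 - ‖b + v * conj u‖ ^ 2 / (s + ‖u‖ ^ 2) := by
  have hs' : 0 < s + ‖u‖ ^ 2 := by positivity
  have hsC : (s : ℂ) ≠ 0 := by exact_mod_cast hs.ne'
  have htC : (s : ℂ) + u * conj u ≠ 0 := by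
    rw [Complex.mul_conj']; exact_mod_cast hs'.ne'
  have : ((‖v - b * u / s‖ ^ 2 / ((s + ‖u‖ ^ 2) / s) + (c - ‖b‖ ^ 2 / s) : ℝ) : ℂ) =
      ((c + ‖v‖ ^ 2 - ‖b + v * conj u‖ ^ 2 / (s + ‖u‖ ^ 2) : ℝ) : ℂ) := by
    push_cast
    simp only [← Complex.mul_conj', map_sub, map_add, map_mul, map_div₀, Complex.conj_conj,
      Complex.conj_ofReal]
    field_simp
    ring
  exact_mod_cast this

theorem kacRice_nonneg {s : ℝ} (hs : 0 < s) {b : ℂ} {c : ℝ} (h : ‖b‖ ^ 2 / s ≤ c) (κ p : ℂ) :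
    0 ≤ kacRice s b c κ p := by
  have := sub_nonneg.2 h
  unfold kacRice
  positivity

instance isProbabilityMeasure_stdComplexGaussian : IsProbabilityMeasure stdComplexGaussian := by
  constructor
  have h := integral_exp_neg_mul_normSq one_pos
  simp only [neg_mul, one_mul, div_one] at h
  have hI := integrable_exp_neg_mul_normSq one_pos
  simp only [neg_mul, one_mul] at hI
  rw [stdComplexGaussian, withDensity_apply _ MeasurableSet.univ, Measure.restrict_univ,
    ← ofReal_integral_eq_lintegral_ofReal (hI.div_const _)
      (Filter.Eventually.of_forall fun _ => by dsimp only [Pi.zero_apply]; positivity),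
    integral_div, h, div_self Real.pi_ne_zero, ENNReal.ofReal_one]

theorem measurable_stdComplexGaussian_density :
    Measurable fun z : ℂ => ENNReal.ofReal (Real.exp (-‖z‖ ^ 2) / Real.pi) := by
  fun_prop

theorem lintegral_stdComplexGaussian (g : ℂ → ENNReal) (hg : Measurable g) :
    ∫⁻ η, g η ∂stdComplexGaussian =
      ∫⁻ η, ENNReal.ofReal (Real.exp (-‖η‖ ^ 2) / Real.pi) * g η := by
  unfold stdComplexGaussian
  rw [lintegral_withDensity_eq_lintegral_mul _ measurable_stdComplexGaussian_density hg]
  rfl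

open ComplexConjugate in
/-- The Cauchy–Schwarz bound on covariance data survives a rank-one update. -/
theorem schur_bound_update {s : ℝ} (hs : 0 < s) {b : ℂ} {c : ℝ} (h : ‖b‖ ^ 2 / s ≤ c) (u v : ℂ) :
    ‖b + v * conj u‖ ^ 2 / (s + ‖u‖ ^ 2) ≤ c + ‖v‖ ^ 2 := by
  have h1 := schur_complement_update hs b c u v
  have : 0 ≤ ‖v - b * u / s‖ ^ 2 / ((s + ‖u‖ ^ 2) / s) := by positivity
  linarith

open ComplexConjugate in
theorem lintegral_kacRice_step {s : ℝ} (hs : 0 < s) {b : ℂ} {c : ℝ} (h : ‖b‖ ^ 2 / s ≤ c)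
    (u v κ p : ℂ) :
    ∫⁻ η, ENNReal.ofReal (kacRice s b c (κ - η * u) (p + η * v)) ∂stdComplexGaussian =
      ENNReal.ofReal (kacRice (s + ‖u‖ ^ 2) (b + v * conj u) (c + ‖v‖ ^ 2) κ p) := by
  have hs' : 0 < s + ‖u‖ ^ 2 := by positivity
  have hc : 0 < (s + ‖u‖ ^ 2) / s := by positivity
  rw [lintegral_stdComplexGaussian _ (by
    have := (continuous_kacRice s b c).comp
      (f := fun η : ℂ => (κ - η * u, p + η * v)) (by fun_prop)
    exact this.measurable.ennreal_ofReal)]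
  simp_rw [← ENNReal.ofReal_mul (show 0 ≤ Real.exp (-‖_‖ ^ 2) / Real.pi by positivity),
    kacRice_integrand_eq hs]
  set A := p + (b + v * conj u) * κ / ((s + ‖u‖ ^ 2 : ℝ) : ℂ) with hA
  set B := v - b * u / s with hB
  set m := conj u * κ / ((s + ‖u‖ ^ 2 : ℝ) : ℂ)
  have hint := (integrable_exp_mul_normSq_affine hc A B (c - ‖b‖ ^ 2 / s)).comp_sub_right m
  rw [← ofReal_integral_eq_lintegral_ofReal (hint.const_mul _), integral_const_mul,
    integral_sub_right_eq_self
      (fun ξ : ℂ => Real.exp (-((s + ‖u‖ ^ 2) / s) * ‖ξ‖ ^ 2) *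
        (‖A + B * ξ‖ ^ 2 + (c - ‖b‖ ^ 2 / s))) m, integral_exp_mul_normSq_affine hc]
  · congr 1
    rw [add_assoc, hB, schur_complement_update hs b c u v, kacRice, hA]
    have := Real.pi_pos
    field_simp
  · refine Filter.Eventually.of_forall fun η => ?_
    have := sub_nonneg.2 h
    simp only [Pi.zero_apply]
    positivity

/-- Tonelli's theorem for a finite power of a measure, with the `k`-th coordinate innermost. -/
theorem lintegral_pi_insertNth {n : ℕ} (γ : Measure ℂ) [IsProbabilityMeasure γ] (k : Fin (n + 1))
    {F : (Fin (n + 1) → ℂ) → ENNReal} (hF : Measurable F) :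
    ∫⁻ η, F η ∂(Measure.pi fun _ : Fin (n + 1) => γ) =
      ∫⁻ y, ∫⁻ x, F (k.insertNth x y) ∂γ ∂(Measure.pi fun _ : Fin n => γ) := by
  have h := (measurePreserving_piFinSuccAbove (fun _ : Fin (n + 1) => γ) k).symm
  rw [← h.lintegral_comp hF, lintegral_prod_symm
    (fun a => F ((MeasurableEquiv.piFinSuccAbove (fun _ => ℂ) k).symm a))
    (hF.comp (MeasurableEquiv.measurable _)).aemeasurable]
  rfl

open ComplexConjugate in
/-- The covariance data add up over independent Gaussian terms. -/
theorem lintegral_kacRice_pi {n : ℕ} (u v : Fin n → ℂ) {s : ℝ} (hs : 0 < s) {b : ℂ} {c : ℝ}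
    (h : ‖b‖ ^ 2 / s ≤ c) (κ p : ℂ) :
    ∫⁻ η, ENNReal.ofReal (kacRice s b c (κ - ∑ j, η j * u j) (p + ∑ j, η j * v j))
        ∂(Measure.pi fun _ : Fin n => stdComplexGaussian) =
      ENNReal.ofReal (kacRice (s + ∑ j, ‖u j‖ ^ 2) (b + ∑ j, v j * conj (u j))
        (c + ∑ j, ‖v j‖ ^ 2) κ p) := by
  induction n generalizing s b c κ p with
  | zero => simp
  | succ n ih =>
    have hcont : Continuous fun η : Fin (n + 1) → ℂ =>
        kacRice s b c (κ - ∑ j, η j * u j) (p + ∑ j, η j * v j) :=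
      (continuous_kacRice s b c).comp
        (f := fun η : Fin (n + 1) → ℂ => (κ - ∑ j, η j * u j, p + ∑ j, η j * v j))
        (by fun_prop)
    rw [lintegral_pi_insertNth _ 0 hcont.measurable.ennreal_ofReal]
    have hstep : ∀ y : Fin n → ℂ, ∫⁻ x, ENNReal.ofReal (kacRice s b c
        (κ - ∑ j, (Fin.insertNth 0 x y : Fin (n + 1) → ℂ) j * u j)
        (p + ∑ j, (Fin.insertNth 0 x y : Fin (n + 1) → ℂ) j * v j)) ∂stdComplexGaussian =
        ENNReal.ofReal (kacRice (s + ‖u 0‖ ^ 2) (b + v 0 * conj (u 0)) (c + ‖v 0‖ ^ 2)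
          (κ - ∑ j, y j * u j.succ) (p + ∑ j, y j * v j.succ)) := by
      intro y
      rw [← lintegral_kacRice_step hs h]
      refine lintegral_congr fun x => ?_
      simp only [Fin.sum_univ_succ, Fin.insertNth_zero', Fin.cons_zero, Fin.cons_succ]
      congr 2 <;> ring
    simp_rw [hstep]
    rw [ih (fun j => u j.succ) (fun j => v j.succ) (by positivity) (schur_bound_update hs h _ _)]
    simp only [Fin.sum_univ_succ, add_assoc]

/-! ### The area formula for holomorphic functions -/

/-- The real Jacobian of a holomorphic function is the squared modulus of its derivative. -/
theorem abs_det_fderiv_holomorphic (c : ℂ) :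
    |((ContinuousLinearMap.toSpanSingleton ℂ c).restrictScalars ℝ : ℂ →L[ℝ] ℂ).det| = ‖c‖ ^ 2 := by
  have h : (((ContinuousLinearMap.toSpanSingleton ℂ c).restrictScalars ℝ : ℂ →L[ℝ] ℂ) :
      ℂ →ₗ[ℝ] ℂ) = LinearMap.mul ℝ ℂ c := by
    ext x
    all_goals simp [mul_comm]
  rw [ContinuousLinearMap.det, h]
  have := Algebra.norm_complex_apply c
  rw [Algebra.norm_apply] at this
  change |LinearMap.det (Algebra.lmul ℝ ℂ c)| = _
  rw [this, Complex.normSq_eq_norm_sq, abs_of_nonneg (by positivity)]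

theorem exists_mem_nhds_injOn {g : ℂ → ℂ} {U : Set ℂ} (hU : IsOpen U)
    (hg : DifferentiableOn ℂ g U) {z : ℂ} (hz : z ∈ U) (h0 : deriv g z ≠ 0) :
    ∃ W ∈ nhds z, Set.InjOn g W := by
  have ha : AnalyticAt ℂ g z := hg.analyticAt (hU.mem_nhds hz)
  have hs := ha.hasStrictDerivAt
  refine ⟨(hs.hasStrictFDerivAt_equiv h0).toOpenPartialHomeomorph g |>.source,
    ((hs.hasStrictFDerivAt_equiv h0).toOpenPartialHomeomorph g).open_source.mem_nhds
      (hs.hasStrictFDerivAt_equiv h0).mem_toOpenPartialHomeomorph_source, ?_⟩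
  exact ((hs.hasStrictFDerivAt_equiv h0).toOpenPartialHomeomorph g).injOn

/-- The noncritical points of a holomorphic function split into countably many measurable pieces
on which the function is injective. -/
theorem exists_partition_injOn {g : ℂ → ℂ} {U A : Set ℂ} (hU : IsOpen U)
    (hg : DifferentiableOn ℂ g U) (hA : MeasurableSet A) (hAU : A ⊆ U)
    (h0 : ∀ z ∈ A, deriv g z ≠ 0) :
    ∃ P : ℕ → Set ℂ, (∀ n, MeasurableSet (P n)) ∧ Pairwise (Function.onFun Disjoint P) ∧
      (⋃ n, P n) = A ∧ ∀ n, Set.InjOn g (P n) := by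
  have h : ∀ z : ℂ, ∃ W : Set ℂ, z ∈ A → IsOpen W ∧ z ∈ W ∧ Set.InjOn g W := by
    intro z
    by_cases hz : z ∈ A
    · obtain ⟨W, hW, hinj⟩ := exists_mem_nhds_injOn hU hg (hAU hz) (h0 z hz)
      obtain ⟨V, hVW, hV, hzV⟩ := mem_nhds_iff.1 hW
      exact ⟨V, fun _ => ⟨hV, hzV, hinj.mono hVW⟩⟩
    · exact ⟨∅, fun h => absurd h hz⟩
  choose W hW using h
  obtain ⟨t, htA, htc, htcov⟩ := TopologicalSpace.countable_cover_nhdsWithin (f := W) (s := A)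
    fun z hz => mem_nhdsWithin_of_mem_nhds ((hW z hz).1.mem_nhds (hW z hz).2.1)
  rcases t.eq_empty_or_nonempty with rfl | hne
  · refine ⟨fun _ => ∅, by simp, fun _ _ _ => by simp [Function.onFun], ?_, by simp⟩
    simpa [eq_comm] using htcov
  obtain ⟨e, rfl⟩ := htc.exists_eq_range hne
  refine ⟨disjointed fun n => A ∩ W (e n), ?_, disjoint_disjointed _, ?_, ?_⟩
  · exact fun n => MeasurableSet.disjointed
      (fun n => hA.inter (hW _ (htA (Set.mem_range_self n))).1.measurableSet) n
  · rw [iUnion_disjointed, ← Set.inter_iUnion]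
    refine Set.inter_eq_left.2 fun z hz => ?_
    simpa using htcov hz
  · exact fun n => (hW _ (htA (Set.mem_range_self n))).2.2.mono
      ((disjointed_subset _ n).trans Set.inter_subset_right)

theorem zeroCount_eq_count {S : ℂ → ℂ} {κ : ℂ} {A : Set ℂ}
    (h : MeasurableSet {z | z ∈ A ∧ S z = κ}) :
    zeroCount S κ A = Measure.count {z | z ∈ A ∧ S z = κ} :=
  (Measure.count_apply h).symm

theorem zeroCount_of_injOn {g : ℂ → ℂ} {A : Set ℂ} (hg : Set.InjOn g A) (w : ℂ) :
    zeroCount g w A = (g '' A).indicator 1 w := by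
  unfold zeroCount
  by_cases hw : w ∈ g '' A
  · obtain ⟨z, hz, rfl⟩ := hw
    have : {x | x ∈ A ∧ g x = g z} = {z} := by
      ext x; constructor
      · exact fun hx => hg hx.1 hz hx.2
      · rintro rfl; exact ⟨hz, rfl⟩
    rw [this, Set.indicator_of_mem (Set.mem_image_of_mem g hz)]
    simp
  · have : {x | x ∈ A ∧ g x = w} = ∅ := by
      ext x; simp only [Set.mem_ofPred_eq, Set.mem_empty_iff_false, iff_false]
      exact fun hx => hw ⟨x, hx.1, hx.2⟩
    rw [this, Set.indicator_of_notMem hw]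
    simp

theorem zeroCount_iUnion {ι : Type*} [Countable ι] {S : ℂ → ℂ} {κ : ℂ} {P : ι → Set ℂ}
    (hd : Pairwise (Function.onFun Disjoint P))
    (hm : ∀ i, MeasurableSet {z | z ∈ P i ∧ S z = κ}) :
    zeroCount S κ (⋃ i, P i) = ∑' i, zeroCount S κ (P i) := by
  have h : {z | z ∈ ⋃ i, P i ∧ S z = κ} = ⋃ i, {z | z ∈ P i ∧ S z = κ} := by
    ext z; simp
  rw [zeroCount_eq_count (h ▸ MeasurableSet.iUnion hm), h, measure_iUnion _ hm]
  · exact tsum_congr fun i => (zeroCount_eq_count (hm i)).symm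
  · exact fun i j hij => (hd hij).mono (fun _ hz => hz.1) fun _ hz => hz.1

/-- Area formula with multiplicity. Critical points are harmless: by Sard's lemma their values form
a null set, and the Jacobian `|g'|²` vanishes there. -/
theorem lintegral_zeroCount_mul {g : ℂ → ℂ} {U A : Set ℂ} (hU : IsOpen U)
    (hg : DifferentiableOn ℂ g U) (hA : MeasurableSet A) (hAU : A ⊆ U) {φ : ℂ → ENNReal}
    (hφ : Measurable φ) :
    ∫⁻ w, φ w * zeroCount g w A = ∫⁻ z in A, ENNReal.ofReal (‖deriv g z‖ ^ 2) * φ (g z) := by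
  have hmd : Measurable (deriv g) := measurable_deriv g
  set C := A ∩ {z | deriv g z = 0} with hC
  set R := A ∩ {z | deriv g z ≠ 0} with hR
  have hCm : MeasurableSet C := hA.inter (hmd (measurableSet_singleton 0))
  have hRm : MeasurableSet R := hA.inter (hmd (measurableSet_singleton 0).compl)
  have hCR : A = C ∪ R := by
    ext z; simp only [hC, hR, Set.mem_union, Set.mem_inter_iff, Set.mem_ofPred_eq]; tauto
  have hdisj : Disjoint C R := Set.disjoint_left.2 fun z h1 h2 => h2.2 h1.2
  have hderiv : ∀ z ∈ A, ∀ s : Set ℂ, HasFDerivWithinAt g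
      ((ContinuousLinearMap.toSpanSingleton ℂ (deriv g z)).restrictScalars ℝ) s z :=
    fun z hz s => ((((hg z (hAU hz)).differentiableAt
      (hU.mem_nhds (hAU hz))).hasDerivAt.hasFDerivAt).restrictScalars ℝ).hasFDerivWithinAt
  have hnull : volume (g '' C) = 0 := by
    refine addHaar_image_eq_zero_of_det_fderivWithin_eq_zero volume
      (f' := fun z => (ContinuousLinearMap.toSpanSingleton ℂ (deriv g z)).restrictScalars ℝ)
      (fun z hz => hderiv z hz.1 C) fun z hz => ?_
    have h0 : deriv g z = 0 := hz.2
    have := abs_det_fderiv_holomorphic (deriv g z)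
    rwa [h0, norm_zero, zero_pow two_ne_zero, abs_eq_zero, ← h0] at this
  obtain ⟨P, hPm, hPd, hPU, hPi⟩ := exists_partition_injOn hU hg hRm
    (Set.inter_subset_left.trans hAU) fun z hz => hz.2
  have hPA : ∀ n, P n ⊆ A := fun n =>
    (Set.subset_iUnion P n).trans (hPU.subset.trans Set.inter_subset_left)
  have hgm : ∀ n, MeasurableSet (g '' P n) := fun n =>
    measurable_image_of_fderivWithin (hPm n) (fun z hz => hderiv z (hPA n hz) _) (hPi n)
  have hae : ∀ᵐ w, φ w * zeroCount g w A = ∑' n, (g '' P n).indicator φ w := by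
    filter_upwards [measure_eq_zero_iff_ae_notMem.1 hnull] with w hw
    have hset : {z | z ∈ A ∧ g z = w} = {z | z ∈ ⋃ n, P n ∧ g z = w} := by
      ext z
      rw [hPU]
      constructor
      · exact fun hz => ⟨⟨hz.1, fun h => hw ⟨z, ⟨hz.1, h⟩, hz.2⟩⟩, hz.2⟩
      · exact fun hz => ⟨hz.1.1, hz.2⟩
    have hsub : ∀ n, MeasurableSet {z | z ∈ P n ∧ g z = w} := fun n =>
      Set.Subsingleton.measurableSet fun x hx y hy => hPi n hx.1 hy.1 (hx.2.trans hy.2.symm)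
    have hz : zeroCount g w A = ∑' n, zeroCount g w (P n) := by
      rw [← zeroCount_iUnion hPd hsub]
      unfold zeroCount
      rw [hset]
    rw [hz, ← ENNReal.tsum_mul_left]
    refine tsum_congr fun n => ?_
    rw [zeroCount_of_injOn (hPi n)]
    by_cases h : w ∈ g '' P n <;> simp [h]
  rw [lintegral_congr_ae hae, lintegral_tsum fun n => (hφ.indicator (hgm n)).aemeasurable,
    hCR, lintegral_union hRm hdisj, ← hPU, lintegral_iUnion hPm hPd]
  have hzero : ∫⁻ z in C, ENNReal.ofReal (‖deriv g z‖ ^ 2) * φ (g z) = 0 := by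
    rw [setLIntegral_congr_fun (g := fun _ => 0) hCm fun z hz => ?_, lintegral_zero]
    have : deriv g z = 0 := hz.2
    simp [this]
  rw [hzero, zero_add]
  refine tsum_congr fun n => ?_
  rw [lintegral_indicator (hgm n), lintegral_image_eq_lintegral_abs_det_fderiv_mul volume (hPm n)
    (fun z hz => hderiv z (hPA n hz) _) (hPi n)]
  simp_rw [abs_det_fderiv_holomorphic]

/-! ### Measurability of the number of solutions -/

/-- The projection along a compact factor is closed. -/
theorem isClosed_setOf_exists_mem_compact {E : Type*} [TopologicalSpace E] {S : E → ℂ → ℂ}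
    (hS : Continuous fun x : E × ℂ => S x.1 x.2) (κ : ℂ) {K : Set ℂ} (hK : IsCompact K) :
    IsClosed {η | ∃ z ∈ K, S η z = κ} := by
  have hcl : IsClosed {x : E × ℂ | S x.1 x.2 = κ} := isClosed_eq hS continuous_const
  rw [← isOpen_compl_iff, isOpen_iff_mem_nhds]
  intro η hη
  have := hK.eventually_forall_of_forall_eventually (x₀ := η)
    (P := fun η z => S η z ≠ κ) fun z hz =>
      hcl.isOpen_compl.mem_nhds (x := (η, z)) fun h => hη ⟨z, hz, h⟩
  filter_upwards [this] with η' h' ⟨z, hz, hzκ⟩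
  exact h' z hz hzκ

theorem measurableSet_setOf_exists_mem {E : Type*} [TopologicalSpace E] [MeasurableSpace E]
    [OpensMeasurableSpace E] {S : E → ℂ → ℂ}
    (hS : Continuous fun x : E × ℂ => S x.1 x.2) (κ : ℂ) {A : Set ℂ} (hA : IsSigmaCompact A) :
    MeasurableSet {η | ∃ z ∈ A, S η z = κ} := by
  obtain ⟨K, hK, rfl⟩ := hA
  have : {η | ∃ z ∈ ⋃ n, K n, S η z = κ} = ⋃ n, {η | ∃ z ∈ K n, S η z = κ} := by
    ext η
    simp only [Set.mem_iUnion, Set.mem_ofPred_eq]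
    constructor
    · rintro ⟨z, ⟨n, hn⟩, h⟩; exact ⟨n, z, hn, h⟩
    · rintro ⟨n, z, hn, h⟩; exact ⟨z, ⟨n, hn⟩, h⟩
  rw [this]
  exact MeasurableSet.iUnion fun n => (isClosed_setOf_exists_mem_compact hS κ (hK n)).measurableSet

theorem IsSigmaCompact.inter_of_isClosed {A C : Set ℂ} (hA : IsSigmaCompact A) (hC : IsClosed C) :
    IsSigmaCompact (A ∩ C) := by
  obtain ⟨K, hK, rfl⟩ := hA
  exact ⟨fun n => K n ∩ C, fun n => (hK n).inter_right hC, (Set.iUnion_inter _ _).symm⟩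

theorem IsSigmaCompact.inter_ne_zero {A : Set ℂ} (hA : IsSigmaCompact A) {g : ℂ → ℂ}
    (hg : Continuous g) : IsSigmaCompact (A ∩ {z | g z ≠ 0}) := by
  have h : A ∩ {z | g z ≠ 0} = ⋃ n : ℕ, A ∩ {z | 1 / ((n : ℝ) + 1) ≤ ‖g z‖} := by
    rw [← Set.inter_iUnion]
    congr 1
    ext z
    simp only [Set.mem_ofPred_eq, Set.mem_iUnion]
    constructor
    · intro hz
      obtain ⟨n, hn⟩ := exists_nat_one_div_lt (norm_pos_iff.2 hz)
      exact ⟨n, hn.le⟩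
    · rintro ⟨n, hn⟩
      exact norm_pos_iff.1 (lt_of_lt_of_le (by positivity) hn)
  rw [h]
  exact isSigmaCompact_iUnion _ fun n =>
    hA.inter_of_isClosed (isClosed_le continuous_const hg.norm)

theorem IsSigmaCompact.measurableSet_complex {A : Set ℂ} (hA : IsSigmaCompact A) :
    MeasurableSet A := by
  obtain ⟨K, hK, rfl⟩ := hA
  exact MeasurableSet.iUnion fun n => (hK n).measurableSet

/-- The cardinality of a set of complex numbers is the largest number of pairwise disjoint closed
sets that meet it, even if these sets are only taken from a fixed countable family. -/
theorem encard_eq_iSup_disjoint (T : Set ℂ) :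
    ((T.encard : ℕ∞) : ENNReal) =
      ⨆ s : {s : Finset (TopologicalSpace.countableBasis ℂ) //
          (s : Set (TopologicalSpace.countableBasis ℂ)).PairwiseDisjoint
            fun B => closure (B : Set ℂ)},
        ∑ B ∈ s.1, {B : TopologicalSpace.countableBasis ℂ |
          (T ∩ closure (B : Set ℂ)).Nonempty}.indicator (fun _ => (1 : ENNReal)) B := by
  classical
  apply le_antisymm
  · refine le_of_forall_lt fun c hc => ?_
    obtain ⟨m, hm, hcm⟩ : ∃ m : ℕ, (m : ℕ∞) ≤ T.encard ∧ c < m := by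
      rcases eq_or_ne T.encard ⊤ with h | h
      · rw [h, ENat.toENNReal_top] at hc
        obtain ⟨m, hm⟩ := ENNReal.exists_nat_gt hc.ne
        exact ⟨m, by rw [h]; exact le_top, hm⟩
      · obtain ⟨m, hm⟩ := ENat.ne_top_iff_exists.1 h
        refine ⟨m, hm.le, ?_⟩
        rwa [← hm, ENat.toENNReal_coe] at hc
    -- Separate `m` points of `T` by members of the family with disjoint closures.
    obtain ⟨t, htT, htm⟩ := Set.exists_subset_encard_eq hm
    have htf : t.Finite := Set.finite_of_encard_eq_coe htm
    obtain ⟨V, hV, hVd⟩ := htf.t2_separation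
    have hB : ∀ z : ℂ, ∃ B : TopologicalSpace.countableBasis ℂ,
        z ∈ (B : Set ℂ) ∧ closure (B : Set ℂ) ⊆ V z := by
      intro z
      obtain ⟨B, hB, hzB, hBV⟩ := (TopologicalSpace.isBasis_countableBasis ℂ).exists_closure_subset
        ((hV z).2.mem_nhds (hV z).1)
      exact ⟨⟨B, hB⟩, hzB, hBV⟩
    choose B hzB hBV using hB
    have hinj : Set.InjOn B t := by
      intro x hx y hy hxy
      by_contra hne
      exact Set.disjoint_left.1 (hVd hx hy hne) (hBV x (subset_closure (hzB x)))
        (hBV y (subset_closure (hxy ▸ hzB x)))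
    have hdisj : ((htf.toFinset.image B : Finset _) :
        Set (TopologicalSpace.countableBasis ℂ)).PairwiseDisjoint
          fun B => closure (B : Set ℂ) := by
      simp only [Finset.coe_image, Set.Finite.coe_toFinset]
      rintro _ ⟨x, hx, rfl⟩ _ ⟨y, hy, rfl⟩ hne
      exact (hVd hx hy fun h => hne (by rw [h])).mono (hBV x) (hBV y)
    refine hcm.trans_le (le_trans ?_ (le_iSup _ ⟨htf.toFinset.image B, hdisj⟩))
    dsimp only
    rw [Finset.sum_image (by simpa using hinj)]
    have h1 : ∀ z ∈ htf.toFinset, ({B : TopologicalSpace.countableBasis ℂ |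
          (T ∩ closure (B : Set ℂ)).Nonempty}.indicator (fun _ => (1 : ENNReal)) (B z)) = 1 := by
      intro z hz
      exact Set.indicator_of_mem (s := {B : TopologicalSpace.countableBasis ℂ |
          (T ∩ closure (B : Set ℂ)).Nonempty})
        ⟨z, htT (htf.mem_toFinset.1 hz), subset_closure (hzB z)⟩ _
    rw [Finset.sum_congr rfl h1, Finset.sum_const, nsmul_one]
    rw [htf.encard_eq_coe_toFinset_card] at htm
    exact_mod_cast htm.ge
  · refine iSup_le fun s => ?_
    obtain ⟨s, hs⟩ := s
    dsimp only
    rw [Finset.sum_indicator_eq_sum_filter, Finset.sum_const, nsmul_one]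
    set s' := s.filter fun B => B ∈ {B : TopologicalSpace.countableBasis ℂ |
      (T ∩ closure (B : Set ℂ)).Nonempty} with hs'
    -- Points chosen in disjoint sets are distinct.
    have hx : ∀ B : TopologicalSpace.countableBasis ℂ, ∃ x : ℂ, B ∈ s' →
        x ∈ T ∧ x ∈ closure (B : Set ℂ) := by
      intro B
      by_cases hB : B ∈ s'
      · obtain ⟨x, hx⟩ := (Finset.mem_filter.1 hB).2
        exact ⟨x, fun _ => hx⟩
      · exact ⟨0, fun h => absurd h hB⟩
    choose x hx using hx
    have hinj : Set.InjOn x (s' : Set (TopologicalSpace.countableBasis ℂ)) := by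
      intro B hB B' hB' h
      by_contra hne
      exact Set.disjoint_left.1 (hs (Finset.mem_filter.1 hB).1 (Finset.mem_filter.1 hB').1 hne)
        (hx B hB).2 (h ▸ (hx B' hB').2)
    have hle : (s' : Set (TopologicalSpace.countableBasis ℂ)).encard ≤ T.encard := by
      rw [← hinj.encard_image]
      exact Set.encard_le_encard (by rintro _ ⟨B, hB, rfl⟩; exact (hx B hB).1)
    rw [Set.encard_coe_eq_coe_finsetCard] at hle
    exact_mod_cast ENat.toENNReal_le.2 hle

/-- The number of solutions in a σ-compact set depends measurably on a parameter that enters the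
equation continuously. -/
theorem measurable_zeroCount {E : Type*} [TopologicalSpace E] [MeasurableSpace E]
    [OpensMeasurableSpace E] {S : E → ℂ → ℂ}
    (hS : Continuous fun x : E × ℂ => S x.1 x.2) (κ : ℂ) {A : Set ℂ} (hA : IsSigmaCompact A) :
    Measurable fun η => zeroCount (S η) κ A := by
  unfold zeroCount
  simp_rw [encard_eq_iSup_disjoint]
  refine Measurable.iSup fun s => Finset.measurable_sum _ fun B _ => ?_
  have hm := measurableSet_setOf_exists_mem hS κ
    (hA.inter_of_isClosed (isClosed_closure (s := (B : Set ℂ))))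
  have hind : Measurable ({η | ∃ z ∈ A ∩ closure (B : Set ℂ), S η z = κ}.indicator
      fun _ => (1 : ENNReal)) := measurable_const.indicator hm
  convert hind using 1
  ext η
  refine Set.indicator_const_eq_indicator_const ?_
  constructor
  · rintro ⟨z, ⟨hz, hzκ⟩, hzB⟩; exact ⟨z, ⟨hz, hzB⟩, hzκ⟩
  · rintro ⟨z, ⟨hz, hzB⟩, hzκ⟩; exact ⟨z, ⟨hz, hzκ⟩, hzB⟩

/-! ### The expected number of solutions for Gaussian coefficients -/

open ComplexConjugate in
theorem kernel_eq_succAbove {N : ℕ} (f : Fin (N + 1) → ℂ → ℂ) (k : Fin (N + 1)) (z : ℂ) :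
    kernelB0 f z = ‖f k z‖ ^ 2 + ∑ j : Fin N, ‖f (k.succAbove j) z‖ ^ 2 ∧
    kernelB1 f z = deriv (f k) z * conj (f k z) +
      ∑ j : Fin N, deriv (f (k.succAbove j)) z * conj (f (k.succAbove j) z) ∧
    kernelB2 f z = ‖deriv (f k) z‖ ^ 2 + ∑ j : Fin N, ‖deriv (f (k.succAbove j)) z‖ ^ 2 := by
  refine ⟨Fin.sum_univ_succAbove _ k, ?_, Fin.sum_univ_succAbove _ k⟩
  rw [kernelB1, Fin.sum_univ_succAbove _ k]
  simp only [mul_comm]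

theorem zeroCount_insertNth {N : ℕ} (f : Fin (N + 1) → ℂ → ℂ) (k : Fin (N + 1)) (κ x : ℂ)
    (y : Fin N → ℂ) {A : Set ℂ} (h : ∀ z ∈ A, f k z ≠ 0) :
    zeroCount (fun z => ∑ j, (k.insertNth x y : Fin (N + 1) → ℂ) j * f j z) κ A =
      zeroCount (fun z => (κ - ∑ j, y j * f (k.succAbove j) z) / f k z) x A := by
  unfold zeroCount
  congr 3
  ext z
  simp only [Fin.sum_univ_succAbove _ k, Fin.insertNth_apply_same,
    Fin.insertNth_apply_succAbove]
  refine and_congr_right fun hz => ?_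
  rw [div_eq_iff (h z hz), sub_eq_iff_eq_add, eq_comm]

open ComplexConjugate in
/-- The integrand of the area formula for `(κ - X) / f`, weighted by the density of the coefficient
`η` of `f`, is the Kac–Rice integrand of the single Gaussian term `η f` at the level left by `X`. -/
theorem normSq_deriv_mul_density {f X : ℂ → ℂ} {z : ℂ} (hf : DifferentiableAt ℂ f z)
    (hX : DifferentiableAt ℂ X z) (h : f z ≠ 0) (κ : ℂ) :
    ENNReal.ofReal (‖deriv (fun z => (κ - X z) / f z) z‖ ^ 2) *
      ENNReal.ofReal (Real.exp (-‖(κ - X z) / f z‖ ^ 2) / Real.pi) =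
      ENNReal.ofReal (kacRice (‖f z‖ ^ 2) (deriv f z * conj (f z)) (‖deriv f z‖ ^ 2) (κ - X z)
        (deriv X z)) := by
  rw [← ENNReal.ofReal_mul (by positivity)]
  congr 1
  have hn : ‖f z‖ ≠ 0 := norm_ne_zero_iff.2 h
  have hc : conj (f z) ≠ 0 := by simpa using h
  rw [((hX.hasDerivAt.const_sub κ).fun_div hf.hasDerivAt h).deriv, kacRice]
  have h1 : deriv X z + deriv f z * conj (f z) * (κ - X z) / ((‖f z‖ ^ 2 : ℝ) : ℂ) =
      -((-deriv X z * f z - (κ - X z) * deriv f z) / f z ^ 2 * f z) := by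
    rw [Complex.ofReal_pow, ← Complex.mul_conj']
    field_simp
    ring
  rw [h1, norm_neg, norm_mul, norm_div, norm_mul, Complex.norm_conj]
  have h2 : ‖deriv f z‖ ^ 2 - (‖deriv f z‖ * ‖f z‖) ^ 2 / ‖f z‖ ^ 2 = 0 := by
    field_simp
    ring
  rw [h2, norm_div, div_pow, neg_div]
  field_simp
  ring

theorem measurable_kacRice {α : Type*} [MeasurableSpace α] {s c : α → ℝ} {b κ p : α → ℂ}
    (hs : Measurable s) (hb : Measurable b) (hc : Measurable c) (hκ : Measurable κ)
    (hp : Measurable p) : Measurable fun x => kacRice (s x) (b x) (c x) (κ x) (p x) := by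
  unfold kacRice
  fun_prop

open ComplexConjugate in
/-- Where `f k` does not vanish, the equation is solved for the `k`-th coefficient, and the area
formula is applied in that coefficient. -/
theorem lintegral_zeroCount_of_ne_zero {N : ℕ} {f : Fin (N + 1) → ℂ → ℂ}
    (hf : ∀ j, Differentiable ℂ (f j)) (k : Fin (N + 1)) (κ : ℂ) {A : Set ℂ}
    (hA : IsSigmaCompact A) (h : ∀ z ∈ A, f k z ≠ 0) :
    ∫⁻ η, zeroCount (fun z => ∑ j, η j * f j z) κ A
        ∂(Measure.pi fun _ : Fin (N + 1) => stdComplexGaussian) =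
      ∫⁻ z in A, ENNReal.ofReal (kacRice (kernelB0 f z) (kernelB1 f z) (kernelB2 f z) κ 0) := by
  have hfc : ∀ j, Continuous (f j) := fun j => (hf j).continuous
  have hAm := hA.measurableSet_complex
  have hm : Measurable fun η : Fin (N + 1) → ℂ => zeroCount (fun z => ∑ j, η j * f j z) κ A :=
    measurable_zeroCount (by fun_prop) κ hA
  rw [lintegral_pi_insertNth _ k hm]
  have hinner : ∀ y : Fin N → ℂ,
      ∫⁻ x, zeroCount (fun z => ∑ j, (k.insertNth x y : Fin (N + 1) → ℂ) j * f j z) κ A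
        ∂stdComplexGaussian =
      ∫⁻ z in A, ENNReal.ofReal (kacRice (‖f k z‖ ^ 2) (deriv (f k) z * conj (f k z))
        (‖deriv (f k) z‖ ^ 2) (κ - ∑ j, y j * f (k.succAbove j) z)
        (0 + ∑ j, y j * deriv (f (k.succAbove j)) z)) := by
    intro y
    have hmy : Measurable fun x : ℂ =>
        zeroCount (fun z => ∑ j, (k.insertNth x y : Fin (N + 1) → ℂ) j * f j z) κ A :=
      hm.comp ((continuous_id.finInsertNth k continuous_const).measurable)
    rw [lintegral_stdComplexGaussian _ hmy]
    simp_rw [zeroCount_insertNth f k κ _ y h]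
    have hX : Differentiable ℂ fun z => ∑ j, y j * f (k.succAbove j) z :=
      Differentiable.fun_sum fun j _ => (hf _).const_mul _
    rw [lintegral_zeroCount_mul (U := {z | f k z ≠ 0}) (isOpen_ne_fun (hfc k) continuous_const)
      (fun z hz => (((hX z).const_sub κ).fun_div (hf k z) hz).differentiableWithinAt) hAm h
      measurable_stdComplexGaussian_density]
    refine setLIntegral_congr_fun hAm fun z hz => ?_
    rw [normSq_deriv_mul_density (hf k z) (hX z) (h z hz), zero_add,
      deriv_fun_sum fun j _ => ((hf _) z).const_mul _]
    simp only [deriv_const_mul_field]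
  simp_rw [hinner]
  have hmd : ∀ j, Measurable (deriv (f j)) := fun j => measurable_deriv _
  have hmf : ∀ j, Measurable (f j) := fun j => (hfc j).measurable
  rw [lintegral_lintegral_swap]
  · refine setLIntegral_congr_fun hAm fun z hz => ?_
    have hz' : 0 < ‖f k z‖ := norm_pos_iff.2 (h z hz)
    rw [lintegral_kacRice_pi _ _ (by positivity)]
    · obtain ⟨h0, h1, h2⟩ := kernel_eq_succAbove f k z
      rw [h0, h1, h2]
    · rw [norm_mul, Complex.norm_conj]
      exact le_of_eq (by field_simp)
  · refine (Measurable.ennreal_ofReal ?_).aemeasurable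
    refine measurable_kacRice ?_ ?_ ?_ ?_ ?_ <;> fun_prop

theorem kacRice_zero_variance (b : ℂ) (c : ℝ) (κ p : ℂ) : kacRice 0 b c κ p = 0 := by
  simp [kacRice]

theorem kernelB0_eq_zero_iff {N : ℕ} {f : Fin (N + 1) → ℂ → ℂ} {z : ℂ} :
    kernelB0 f z = 0 ↔ ∀ j, f j z = 0 := by
  rw [kernelB0, Finset.sum_eq_zero_iff_of_nonneg fun _ _ => by positivity]
  simp

/-- Expected number of solutions at a nonzero level. The domain is cut according to the first `f k`
that does not vanish; where all `f j` vanish there are no solutions and the right-hand integrand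
is `0` by the convention on division by zero. -/
theorem lintegral_zeroCount_pi {N : ℕ} {f : Fin (N + 1) → ℂ → ℂ}
    (hf : ∀ j, Differentiable ℂ (f j)) {κ : ℂ} (hκ : κ ≠ 0) {Φ : Set ℂ} (hΦ : IsCompact Φ) :
    ∫⁻ η, zeroCount (fun z => ∑ j, η j * f j z) κ Φ
        ∂(Measure.pi fun _ : Fin (N + 1) => stdComplexGaussian) =
      ∫⁻ z in Φ, ENNReal.ofReal (kacRice (kernelB0 f z) (kernelB1 f z) (kernelB2 f z) κ 0) := by
  have hfc : ∀ j, Continuous (f j) := fun j => (hf j).continuous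
  let A : Fin (N + 1) → Set ℂ := fun k =>
    (Φ ∩ {z | ∀ j < k, f j z = 0}) ∩ {z | f k z ≠ 0}
  have hA : ∀ k, IsSigmaCompact (A k) := fun k => by
    refine (hΦ.isSigmaCompact.inter_of_isClosed ?_).inter_ne_zero (hfc k)
    simp only [Set.ofPred_forall]
    exact isClosed_iInter fun j => isClosed_iInter fun _ => isClosed_eq (hfc j) continuous_const
  have hAm : ∀ k, MeasurableSet (A k) := fun k => (hA k).measurableSet_complex
  have hd : Pairwise (Function.onFun Disjoint A) := by
    intro k l hkl
    refine Set.disjoint_left.2 fun z hk hl => ?_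
    rcases lt_or_gt_of_ne hkl with hlt | hlt
    · exact hk.2 (hl.1.2 k hlt)
    · exact hl.2 (hk.1.2 l hlt)
  have hU : ⋃ k, A k = Φ ∩ {z | ¬ ∀ j, f j z = 0} := by
    ext z
    simp only [A, Set.mem_iUnion, Set.mem_inter_iff, Set.mem_ofPred_eq]
    constructor
    · rintro ⟨k, ⟨hz, -⟩, hk⟩
      exact ⟨hz, fun h => hk (h k)⟩
    · rintro ⟨hz, hne⟩
      push Not at hne
      obtain ⟨k, hk, hmin⟩ := WellFounded.has_min (wellFounded_lt (α := Fin (N + 1)))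
        {k | f k z ≠ 0} hne
      exact ⟨k, ⟨hz, fun j hj => by_contra fun h => hmin j h hj⟩, hk⟩
  have hcount : ∀ η : Fin (N + 1) → ℂ, zeroCount (fun z => ∑ j, η j * f j z) κ Φ =
      ∑ k, zeroCount (fun z => ∑ j, η j * f j z) κ (A k) := by
    intro η
    have hcont : Continuous fun z => ∑ j, η j * f j z := by fun_prop
    rw [← tsum_fintype (L := .unconditional _), ← zeroCount_iUnion hd fun k =>
      (hAm k).inter (isClosed_eq hcont continuous_const).measurableSet, hU]
    unfold zeroCount
    congr 3
    ext z
    simp only [Set.mem_ofPred_eq, Set.mem_inter_iff]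
    constructor
    · rintro ⟨hz, hs⟩
      refine ⟨⟨hz, fun h => hκ ?_⟩, hs⟩
      rw [← hs]
      simp [h]
    · exact fun hz => ⟨hz.1.1, hz.2⟩
  simp_rw [hcount]
  rw [lintegral_finsetSum _ fun k _ => measurable_zeroCount (by fun_prop) κ (hA k),
    Finset.sum_congr rfl fun k _ => lintegral_zeroCount_of_ne_zero hf k κ (hA k) fun z hz => hz.2,
    ← tsum_fintype (L := .unconditional _), ← lintegral_iUnion hAm hd, hU]
  rw [← lintegral_indicator (hU ▸ MeasurableSet.iUnion hAm),
    ← lintegral_indicator hΦ.measurableSet]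
  refine lintegral_congr fun z => ?_
  classical
  by_cases hz : ∀ j, f j z = 0
  · rw [Set.indicator_of_notMem fun h => h.2 hz, Set.indicator_apply, kernelB0_eq_zero_iff.2 hz,
      kacRice_zero_variance]
    simp
  · by_cases hzΦ : z ∈ Φ <;> simp [Set.indicator, hz, hzΦ]

/-! ### The joint law of the coefficients -/

theorem measurable_complexOfParts {Ω : Type*} [MeasurableSpace Ω] {x y : Ω → ℝ}
    (hx : Measurable x) (hy : Measurable y) : Measurable (complexOfParts x y) := by
  unfold complexOfParts
  fun_prop

theorem map_complexOfParts_eq_prod {Ω : Type*} [MeasurableSpace Ω] {P : Measure Ω}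
    [IsProbabilityMeasure P] {x y : Ω → ℝ} (hx : Measurable x) (hy : Measurable y)
    (h : IndepFun x y P) :
    P.map (complexOfParts x y) =
      ((P.map x).prod (P.map y)).map fun p : ℝ × ℝ => (p.1 : ℂ) + Complex.I * p.2 := by
  rw [← h.map_prod_eq_prod_map_map hx.aemeasurable hy.aemeasurable,
    Measure.map_map (by fun_prop) (by fun_prop)]
  rfl

theorem map_coefficients_eq_pi {Ω : Type*} [MeasurableSpace Ω] {P : Measure Ω}
    [IsProbabilityMeasure P] {n : ℕ} {a b : Fin n → Ω → ℝ} (ha : ∀ j, Measurable (a j))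
    (hb : ∀ j, Measurable (b j)) (h : iIndepFun (Sum.elim a b) P) :
    P.map (fun ω j => complexOfParts (a j) (b j) ω) =
      Measure.pi fun j => P.map (complexOfParts (a j) (b j)) := by
  have hm : ∀ i, Measurable (Sum.elim a b i) := by rintro (j | j); exacts [ha j, hb j]
  have hprob : ∀ i, IsProbabilityMeasure (P.map (Sum.elim a b i)) := fun i =>
    Measure.isProbabilityMeasure_map (hm i).aemeasurable
  have hpa : ∀ j, IsProbabilityMeasure (P.map (a j)) := fun j =>
    Measure.isProbabilityMeasure_map (ha j).aemeasurable
  have hpb : ∀ j, IsProbabilityMeasure (P.map (b j)) := fun j =>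
    Measure.isProbabilityMeasure_map (hb j).aemeasurable
  have h1 := h.map_fun_eq_pi_map fun i => (hm i).aemeasurable
  have h2 := (measurePreserving_sumPiEquivProdPi fun i => P.map (Sum.elim a b i)).map_eq
  have h3 := (measurePreserving_arrowProdEquivProdArrow ℝ ℝ (Fin n) (fun j => P.map (a j))
    fun j => P.map (b j)).symm.map_eq
  have hpair : P.map (fun ω j => (a j ω, b j ω)) =
      Measure.pi fun j => (P.map (a j)).prod (P.map (b j)) := by
    rw [← h3]
    have h2' : P.map (fun ω => ((fun j => a j ω), fun j => b j ω)) =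
        (Measure.pi fun j => P.map (a j)).prod (Measure.pi fun j => P.map (b j)) := by
      rw [← h1, Measure.map_map (MeasurableEquiv.measurable _) (measurable_pi_iff.2 hm)] at h2
      exact h2
    rw [← h2', Measure.map_map (MeasurableEquiv.measurable _) (by fun_prop)]
    rfl
  have hg : Measurable fun p : ℝ × ℝ => (p.1 : ℂ) + Complex.I * p.2 := by fun_prop
  have hpm : ∀ j, IsProbabilityMeasure (((P.map (a j)).prod (P.map (b j))).map
      fun p : ℝ × ℝ => (p.1 : ℂ) + Complex.I * p.2) := fun j =>
    Measure.isProbabilityMeasure_map hg.aemeasurable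
  have hind : ∀ j, IndepFun (a j) (b j) P := fun j =>
    h.indepFun (i := Sum.inl j) (j := Sum.inr j) (by simp)
  simp_rw [fun j => map_complexOfParts_eq_prod (ha j) (hb j) (hind j)]
  rw [← Measure.pi_map_pi fun j => hg.aemeasurable, ← hpair,
    Measure.map_map (by fun_prop) (by fun_prop)]
  rfl

theorem map_prod_gaussianReal_half :
    ((gaussianReal 0 (1 / 2)).prod (gaussianReal 0 (1 / 2))).map
      (fun p : ℝ × ℝ => (p.1 : ℂ) + Complex.I * p.2) = stdComplexGaussian := by
  have hv : (1 / 2 : NNReal) ≠ 0 := by norm_num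
  rw [gaussianReal_of_var_ne_zero _ hv,
    prod_withDensity (measurable_gaussianPDF _ _) (measurable_gaussianPDF _ _)]
  refine Measure.ext_of_lintegral _ fun φ hφ => ?_
  have hg : Measurable fun p : ℝ × ℝ => (p.1 : ℂ) + Complex.I * p.2 := by fun_prop
  have hd : Measurable fun p : ℝ × ℝ =>
      gaussianPDF 0 (1 / 2) p.1 * gaussianPDF 0 (1 / 2) p.2 :=
    ((measurable_gaussianPDF _ _).comp measurable_fst).mul
      ((measurable_gaussianPDF _ _).comp measurable_snd)
  rw [lintegral_map hφ hg, lintegral_withDensity_eq_lintegral_mul _ hd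
      (g := fun p : ℝ × ℝ => φ ((p.1 : ℂ) + Complex.I * p.2)) (hφ.comp hg),
    lintegral_stdComplexGaussian _ hφ, ← Measure.volume_eq_prod,
    ← Complex.volume_preserving_equiv_real_prod.lintegral_comp (hd.mul
      (g := fun p : ℝ × ℝ => φ ((p.1 : ℂ) + Complex.I * p.2)) (hφ.comp hg))]
  refine lintegral_congr fun z => ?_
  have h1 : ((z.re : ℂ) + Complex.I * z.im) = z := by rw [mul_comm, Complex.re_add_im]
  simp only [Pi.mul_apply, Complex.measurableEquivRealProd_apply, h1]
  congr 1
  rw [gaussianPDF, gaussianPDF, ← ENNReal.ofReal_mul (gaussianPDFReal_nonneg _ _ _)]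
  congr 1
  have hs : √(2 * Real.pi * ((1 / 2 : NNReal) : ℝ)) = √Real.pi := by congr 1; push_cast; ring
  rw [gaussianPDFReal, gaussianPDFReal, hs, ← Complex.normSq_eq_norm_sq, Complex.normSq_apply,
    mul_mul_mul_comm, ← mul_inv, Real.mul_self_sqrt Real.pi_pos.le, ← Real.exp_add, inv_mul_eq_div]
  congr 2
  push_cast
  ring

theorem map_complexOfParts_div_sqrt_two {Ω : Type*} [MeasurableSpace Ω] {P : Measure Ω}
    [IsProbabilityMeasure P] {x y : Ω → ℝ} (hx : Measurable x) (hy : Measurable y)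
    (h : IndepFun x y P) (hxl : P.map x = gaussianReal 0 1) (hyl : P.map y = gaussianReal 0 1) :
    P.map (complexOfParts (fun ω => x ω / √2) fun ω => y ω / √2) = stdComplexGaussian := by
  have hscale : ∀ {u : Ω → ℝ}, Measurable u → P.map u = gaussianReal 0 1 →
      P.map (fun ω => u ω / √2) = gaussianReal 0 (1 / 2) := by
    intro u hu hul
    have : (fun ω => u ω / √2) = (fun t : ℝ => t / √2) ∘ u := rfl
    rw [this, ← Measure.map_map (by fun_prop) hu, hul, gaussianReal_map_div_const, zero_div]
    congr 1
    ext
    simp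
  have hind : IndepFun (fun ω => x ω / √2) (fun ω => y ω / √2) P :=
    h.comp (φ := fun t : ℝ => t / √2) (ψ := fun t : ℝ => t / √2) (by fun_prop) (by fun_prop)
  rw [map_complexOfParts_eq_prod (by fun_prop) (by fun_prop) hind, hscale hx hxl, hscale hy hyl,
    map_prod_gaussianReal_half]

/-! ### The density: regularity and uniqueness -/

theorem kernelB0_nonneg {N : ℕ} (f : Fin (N + 1) → ℂ → ℂ) (z : ℂ) : 0 ≤ kernelB0 f z :=
  Finset.sum_nonneg fun _ _ => by positivity

theorem circleDensity_eq_kacRice {N : ℕ} (f : Fin (N + 1) → ℂ → ℂ) (κ z : ℂ) :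
    circleDensity f ‖κ‖ z = kacRice (kernelB0 f z) (kernelB1 f z) (kernelB2 f z) κ 0 := by
  rw [circleDensity, kacRice, zero_add, norm_div, norm_mul, Complex.norm_of_nonneg (kernelB0_nonneg f z)]
  ring

theorem normSq_kernelB1_le {N : ℕ} (f : Fin (N + 1) → ℂ → ℂ) (z : ℂ) :
    ‖kernelB1 f z‖ ^ 2 ≤ kernelB0 f z * kernelB2 f z := by
  have h : ‖kernelB1 f z‖ ≤ ∑ j, ‖f j z‖ * ‖deriv (f j) z‖ := by
    refine (norm_sum_le _ _).trans (le_of_eq ?_)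
    simp only [norm_mul, Complex.norm_conj]
  exact (pow_le_pow_left₀ (norm_nonneg _) h 2).trans (Finset.sum_mul_sq_le_sq_mul_sq _ _ _)

theorem kernelB2_nonneg {N : ℕ} (f : Fin (N + 1) → ℂ → ℂ) (z : ℂ) : 0 ≤ kernelB2 f z :=
  Finset.sum_nonneg fun _ _ => by positivity

theorem circleDensity_nonneg {N : ℕ} (f : Fin (N + 1) → ℂ → ℂ) (κ z : ℂ) :
    0 ≤ circleDensity f ‖κ‖ z := by
  rw [circleDensity_eq_kacRice]
  rcases (kernelB0_nonneg f z).eq_or_lt with h | h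
  · rw [← h, kacRice_zero_variance]
  · refine kacRice_nonneg h ?_ _ _
    rw [div_le_iff₀ h, mul_comm]
    exact normSq_kernelB1_le f z

/-- The factor `exp (-K² / B₀)` compensates the singularity of the density at common zeros of the
`f j`. -/
theorem circleDensity_le {N : ℕ} (f : Fin (N + 1) → ℂ → ℂ) {K : ℝ} (hK : 0 < K) (z : ℂ) :
    circleDensity f K z ≤ 2 / (Real.pi * K ^ 2) * kernelB2 f z := by
  have h2 := kernelB2_nonneg f z
  rcases (kernelB0_nonneg f z).eq_or_lt with h | h
  · rw [circleDensity, ← h]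
    simp only [mul_zero, div_zero, zero_mul]
    positivity
  have hb : ‖kernelB1 f z‖ ^ 2 / kernelB0 f z ≤ kernelB2 f z := by
    rw [div_le_iff₀ h, mul_comm]
    exact normSq_kernelB1_le f z
  have hb0 : 0 ≤ ‖kernelB1 f z‖ ^ 2 / kernelB0 f z := by positivity
  rw [circleDensity]
  set s := kernelB0 f z
  set B := kernelB2 f z
  set β := ‖kernelB1 f z‖ ^ 2 / s
  have hs : s = K ^ 2 / (K ^ 2 / s) := by field_simp
  rw [neg_div]
  set t := K ^ 2 / s with ht
  have ht0 : 0 < t := by positivity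
  have h1 : B - β * (1 - t) ≤ B * (1 + t) := by nlinarith
  have hexp : Real.exp (-t) * (t * (1 + t)) ≤ 2 := by
    rw [Real.exp_neg, inv_mul_le_iff₀ (Real.exp_pos t)]
    have := Real.quadratic_le_exp_of_nonneg ht0.le
    nlinarith
  calc Real.exp (-t) / (Real.pi * s) * (B - β * (1 - t))
      ≤ Real.exp (-t) / (Real.pi * s) * (B * (1 + t)) := by gcongr
    _ = Real.exp (-t) * (t * (1 + t)) * (B / (Real.pi * K ^ 2)) := by rw [hs]; field_simp
    _ ≤ 2 * (B / (Real.pi * K ^ 2)) := by gcongr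
    _ = 2 / (Real.pi * K ^ 2) * B := by ring

theorem continuous_deriv_of_differentiable {g : ℂ → ℂ} (hg : Differentiable ℂ g) :
    Continuous (deriv g) :=
  (hg.contDiff (n := 1)).continuous_deriv le_rfl

theorem continuous_kernels {N : ℕ} {f : Fin (N + 1) → ℂ → ℂ} (hf : ∀ j, Differentiable ℂ (f j)) :
    Continuous (kernelB0 f) ∧ Continuous (kernelB1 f) ∧ Continuous (kernelB2 f) := by
  have hc : ∀ j, Continuous (f j) := fun j => (hf j).continuous
  have hd : ∀ j, Continuous (deriv (f j)) := fun j => continuous_deriv_of_differentiable (hf j)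
  refine ⟨?_, ?_, ?_⟩
  · unfold kernelB0; fun_prop
  · unfold kernelB1; fun_prop
  · unfold kernelB2; fun_prop

theorem continuousAt_circleDensity {N : ℕ} {f : Fin (N + 1) → ℂ → ℂ}
    (hf : ∀ j, Differentiable ℂ (f j)) (K : ℝ) {z : ℂ} (hz : kernelB0 f z ≠ 0) :
    ContinuousAt (circleDensity f K) z := by
  obtain ⟨h0, h1, h2⟩ := continuous_kernels hf
  have hπ : Real.pi * kernelB0 f z ≠ 0 := mul_ne_zero Real.pi_ne_zero hz
  unfold circleDensity
  fun_prop (disch := assumption)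

theorem locallyIntegrable_circleDensity {N : ℕ} {f : Fin (N + 1) → ℂ → ℂ}
    (hf : ∀ j, Differentiable ℂ (f j)) {κ : ℂ} (hκ : κ ≠ 0) :
    LocallyIntegrable (circleDensity f ‖κ‖) volume := by
  obtain ⟨h0, h1, h2⟩ := continuous_kernels hf
  refine (h2.const_mul (2 / (Real.pi * ‖κ‖ ^ 2))).locallyIntegrable.mono ?_
    (Filter.Eventually.of_forall fun z => ?_)
  · have := h0.measurable
    have := h1.measurable
    have := h2.measurable
    refine Measurable.aestronglyMeasurable ?_
    unfold circleDensity
    fun_prop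
  · have := kernelB2_nonneg f z
    rw [Real.norm_of_nonneg (circleDensity_nonneg f κ z), Real.norm_of_nonneg (by positivity)]
    exact circleDensity_le f (norm_pos_iff.2 hκ) z

/-- The Kac–Rice formula for independent standard complex Gaussian coefficients. -/
theorem isZeroDensity_circleDensity {Ω : Type*} [MeasurableSpace Ω] {P : Measure Ω} {N : ℕ}
    {f : Fin (N + 1) → ℂ → ℂ} (hf : ∀ j, Differentiable ℂ (f j)) {a b : Fin (N + 1) → Ω → ℝ}
    (ha : ∀ j, Measurable (a j)) (hb : ∀ j, Measurable (b j))
    (hlaw : P.map (fun ω j => complexOfParts (a j) (b j) ω) =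
      Measure.pi fun _ => stdComplexGaussian) {κ : ℂ} (hκ : κ ≠ 0) :
    IsZeroDensity P (randomSum a b f) κ (circleDensity f ‖κ‖) := by
  have hη : Measurable fun ω j => complexOfParts (a j) (b j) ω :=
    measurable_pi_iff.2 fun j => measurable_complexOfParts (ha j) (hb j)
  have hfc : ∀ j, Continuous (f j) := fun j => (hf j).continuous
  have hcount : ∀ Φ : Set ℂ, IsCompact Φ → Measurable fun η : Fin (N + 1) → ℂ =>
      zeroCount (fun z => ∑ j, η j * f j z) κ Φ := fun Φ hΦ =>
    measurable_zeroCount (by fun_prop) κ hΦ.isSigmaCompact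
  have hL := locallyIntegrable_circleDensity hf hκ
  have hE : ∀ Φ : Set ℂ, IsCompact Φ → ∫⁻ ω, zeroCount (randomSum a b f ω) κ Φ ∂P =
      ∫⁻ z in Φ, ENNReal.ofReal (circleDensity f ‖κ‖ z) := by
    intro Φ hΦ
    simp_rw [circleDensity_eq_kacRice]
    rw [← lintegral_zeroCount_pi hf hκ hΦ, ← hlaw, lintegral_map (hcount Φ hΦ) hη]
    rfl
  refine ⟨hL, fun Φ hΦ => ((hcount Φ hΦ).comp hη).aemeasurable, fun Φ hΦ => ?_, fun Φ hΦ => ?_⟩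
  · rw [hE Φ hΦ]
    exact (hL.integrableOn_isCompact hΦ).lintegral_lt_top.ne
  · rw [hE Φ hΦ, integral_eq_lintegral_of_nonneg_ae
      (Filter.Eventually.of_forall fun z => circleDensity_nonneg f κ z)
      (hL.integrableOn_isCompact hΦ).aestronglyMeasurable]

theorem IsZeroDensity.ae_eq {Ω : Type*} [MeasurableSpace Ω] {P : Measure Ω} {S : Ω → ℂ → ℂ}
    {κ : ℂ} {g h : ℂ → ℝ} (hg : IsZeroDensity P S κ g) (hh : IsZeroDensity P S κ h) :
    ∀ᵐ z, h z = g z := by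
  have := ae_eq_zero_of_forall_setIntegral_isCompact_eq_zero'
    (hh.locallyIntegrable.sub hg.locallyIntegrable) fun Φ hΦ => by
      simp only [Pi.sub_apply]
      rw [integral_sub (hh.locallyIntegrable.integrableOn_isCompact hΦ)
        (hg.locallyIntegrable.integrableOn_isCompact hΦ), ← hh.expectation_eq Φ hΦ,
        ← hg.expectation_eq Φ hΦ, sub_self]
  filter_upwards [this] with z hz
  exact sub_eq_zero.1 hz

theorem eq_of_ae_eq_of_continuousAt {g h : ℂ → ℝ} (hgh : ∀ᵐ z, h z = g z) {z : ℂ}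
    (hh : ContinuousAt h z) (hg : ContinuousAt g z) : h z = g z := by
  by_contra hne
  have hev : ∀ᶠ w in nhds z, h w - g w ≠ 0 := (hh.sub hg).eventually_ne (sub_ne_zero.2 hne)
  have hpos : 0 < volume {w | h w - g w ≠ 0} := Measure.measure_pos_of_mem_nhds volume hev
  refine hpos.ne' (measure_mono_null (fun w hw => ?_) (ae_iff.1 hgh))
  exact sub_ne_zero.1 hw

theorem zeroCount_randomSum_div {Ω : Type*} {N : ℕ} (a b : Fin (N + 1) → Ω → ℝ)
    (f : Fin (N + 1) → ℂ → ℂ) {c : ℝ} (hc : c ≠ 0) (κ : ℂ) (ω : Ω) :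
    zeroCount (randomSum (fun j ω => a j ω / c) (fun j ω => b j ω / c) f ω) (κ / c) =
      zeroCount (randomSum a b f ω) κ := by
  have hcC : (c : ℂ) ≠ 0 := by exact_mod_cast hc
  have h : ∀ z, randomSum (fun j ω => a j ω / c) (fun j ω => b j ω / c) f ω z =
      randomSum a b f ω z / c := by
    intro z
    simp only [randomSum, complexOfParts, Finset.sum_div]
    refine Finset.sum_congr rfl fun j _ => ?_
    push_cast
    ring
  funext Φ
  unfold zeroCount
  simp_rw [h, div_left_inj' hcC]

theorem corollary1 {Ω : Type*} [MeasurableSpace Ω] (P : Measure Ω) [IsProbabilityMeasure P]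
    (N : ℕ) (hN : 0 < N)
    (f : Fin (N + 1) → ℂ → ℂ)
    (hf : ∀ j, AnalyticOnNhd ℂ (f j) Set.univ)
    (hreal : ∀ j, ∀ x : ℝ, (f j (x : ℂ)).im = 0)
    (a b : Fin (N + 1) → Ω → ℝ)
    (ha : ∀ j, Measurable (a j)) (hb : ∀ j, Measurable (b j))
    (hindep : iIndepFun (Sum.elim a b) P)
    (K : ℝ) (hK : 0 < K) (K₁ K₂ : ℝ)
    -- Either `η_j` has density `e^{-z z̄} / π` and the level has modulus `K`,
    -- or `a_j, b_j` have variance one and the level satisfies `(K₁² + K₂²) / 2 = K²`.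
    (hlevel :
      ((∀ j, P.map (complexOfParts (a j) (b j)) = stdComplexGaussian) ∧
        K₁ ^ 2 + K₂ ^ 2 = K ^ 2) ∨
      ((∀ j, P.map (a j) = gaussianReal 0 1 ∧ P.map (b j) = gaussianReal 0 1) ∧
        (K₁ ^ 2 + K₂ ^ 2) / 2 = K ^ 2)) :
    IsZeroDensity P (randomSum a b f) (⟨K₁, K₂⟩ : ℂ) (circleDensity f K) ∧
    ∀ h : ℂ → ℝ, IsZeroDensity P (randomSum a b f) (⟨K₁, K₂⟩ : ℂ) h →
      (∀ᵐ z, h z = circleDensity f K z) ∧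
      ∀ z, kernelB0 f z ≠ 0 → ContinuousAt h z → h z = circleDensity f K z := by
  have hfd : ∀ j, Differentiable ℂ (f j) := fun j z => (hf j z (Set.mem_univ z)).differentiableAt
  have hnorm : ‖(⟨K₁, K₂⟩ : ℂ)‖ ^ 2 = K₁ ^ 2 + K₂ ^ 2 := by
    rw [← Complex.normSq_eq_norm_sq, Complex.normSq_mk]
    ring
  have hmain : IsZeroDensity P (randomSum a b f) (⟨K₁, K₂⟩ : ℂ) (circleDensity f K) := by
    rcases hlevel with ⟨hlaw, hKK⟩ | ⟨hlaw, hKK⟩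
    · have hκ : ‖(⟨K₁, K₂⟩ : ℂ)‖ = K :=
        (pow_left_inj₀ (norm_nonneg _) hK.le two_ne_zero).1 (hnorm.trans hKK)
      rw [← hκ]
      refine isZeroDensity_circleDensity hfd ha hb ?_ (norm_pos_iff.1 (hκ ▸ hK))
      rw [map_coefficients_eq_pi ha hb hindep]
      simp_rw [hlaw]
    · -- Dividing the equation by `√2` reduces variance one to variance `1 / 2`.
      have h2 : √(2 : ℝ) ≠ 0 := by positivity
      have hκ : ‖(⟨K₁, K₂⟩ : ℂ) / (√2 : ℝ)‖ = K := by
        refine (pow_left_inj₀ (norm_nonneg _) hK.le two_ne_zero).1 ?_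
        rw [norm_div, div_pow, hnorm, Complex.norm_of_nonneg (Real.sqrt_nonneg 2),
          Real.sq_sqrt zero_le_two, hKK]
      have ha' : ∀ j, Measurable fun ω => a j ω / √2 := fun j => (ha j).div_const _
      have hb' : ∀ j, Measurable fun ω => b j ω / √2 := fun j => (hb j).div_const _
      have hindep' : iIndepFun (Sum.elim (fun j ω => a j ω / √2) fun j ω => b j ω / √2) P := by
        convert hindep.comp (fun _ t => t / √2) fun _ => by fun_prop using 1
        funext i
        rcases i with j | j <;> rfl
      have hD := isZeroDensity_circleDensity (P := P) hfd ha' hb' (by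
        rw [map_coefficients_eq_pi ha' hb' hindep']
        congr 1
        funext j
        exact map_complexOfParts_div_sqrt_two (ha j) (hb j)
          (hindep.indepFun (i := Sum.inl j) (j := Sum.inr j) (by simp)) (hlaw j).1 (hlaw j).2)
        (norm_pos_iff.1 (hκ ▸ hK))
      rw [hκ] at hD
      have hz := zeroCount_randomSum_div a b f h2 ⟨K₁, K₂⟩
      exact ⟨hD.locallyIntegrable, by simpa only [hz] using hD.aemeasurable_count,
        by simpa only [hz] using hD.expectation_ne_top,
        by simpa only [hz] using hD.expectation_eq⟩
  refine ⟨hmain, fun h hh => ⟨hmain.ae_eq hh, fun z hz hc => ?_⟩⟩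
  exact eq_of_ae_eq_of_continuousAt (hmain.ae_eq hh) hc (continuousAt_circleDensity hfd K hz)
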